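/- Let $N$ be a finite-dimensional $C^*$-algebra and $\nu\colon N\to\mathbb C$ a faithful positive linear functional. Choose a basis $(a_i)$ of $N$, let $(b_i)$ be the dual basis, $\nu(b_ia_j)=\delta_{ij}$, and suppose that $\nu$ has index $1$, i.e. $\sum_i a_ib_i=1$. Let $\theta$ be the modular automorphism, $\nu(xy)=\nu(y\,\theta(x))$, let $g\in N$ be a positive invertible element with $\theta(x)=gxg^{-1}$, put $\theta^{1/2}(x)=g^{1/2}xg^{-1/2}$ and $$e_\nu=\sum_i a_i\otimes\theta^{1/2}(b_i)\in N^{o}\otimes N .$$ Let $H$ be a finite-dimensional Hilbert space and let $\beta\colon N\to L(H)$, $\alpha\colon N^{o}\to L(H)$, $\hat\beta\colon N\to L(H)$ be $*$-homomorphisms (not necessarily unital) with pairwise commuting ranges. Put $$E=(\alpha\otimes\beta)(e_\nu),\qquad \hat E=(\hat\beta\otimes\alpha)(e_\nu)$$ (for $\hat E$, $e_\nu$ is read as an element of $N\otimes N^{o}$). These are the projections in $L(H\otimes H)$ whose ranges are the relative tensor products $H_\alpha\otimes_\nu{}_\beta H$ and $H_{\hat\beta}\otimes_{\nu^o}{}_\alpha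 H$. Let $U\colon \hat E(H\otimes H)\to E(H\otimes H)$ be a pseudo-multiplicative isometry, i.e. a linear isometry of $\hat E(H\otimes H)$ onto $E(H\otimes H)$ such that 1. for all $x\in N$, $$U(\beta(x)\otimes1)=(\beta(x)\otimes1)U,\quad U(1\otimes\beta(x))=(\hat\beta(x)\otimes1)U,\quad U(1\otimes\hat\beta(x))=(1\otimes\hat\beta(x))U,\quad U(\alpha(x)\otimes1)=(1\otimes\alpha(x))U$$ on $\hat E(H\otimes H)$; 2. the pentagon diagram commutes: the two composites $$\hat E_{12}\hat E_{23}\xrightarrow{U_{12}}E_{12}\hat E_{23}\xrightarrow{U_{23}}E_{12}E_{23},$$ $$\hat E_{12}\hat E_{23}\xrightarrow{U_{23}}\hat E_{13}E_{23}\xrightarrow{\Sigma_{2,3}}\hat E_{12}E_{32}\xrightarrow{\Sigma_{12,3}}E_{13}\hat E_{23}\xrightarrow{U_{23}}\hat E_{21}E_{23}\xrightarrow{\Sigma_{1,2}}E_{13}\hat E_{12}\xrightarrow{U_{12}}E_{12}E_{23}$$ coincide. Here each product of commuting projections stands for its range in $H\otimes H\otimes H$, indices denote the tensor factors acted upon (in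 the given order of the legs), $U_{12}=U\otimes1$ and $U_{23}=1\otimes U$, and the flips are $\Sigma_{1,2}(\xi\otimes\eta\otimes\zeta)=\eta\otimes\xi\otimes\zeta$, $\Sigma_{2,3}(\xi\otimes\eta\otimes\zeta)=\xi\otimes\zeta\otimes\eta$, $\Sigma_{12,3}(\xi\otimes\eta\otimes\zeta)=\zeta\otimes\xi\otimes\eta$. Then $V:=EU\hat E\in L(H\otimes H)$ restricts to $U$ on $\hat E(H\otimes H)$, satisfies $VV^*=E$ and $V^*V=\hat E$, and is a multiplicative partial isometry, i.e. $VV^*V=V$ and, on $H\otimes H\otimes H$, $$V_{23}V_{12}=V_{12}V_{13}V_{23},\qquad V_{13}V_{23}V_{23}^*=V_{12}^*V_{12}V_{13},$$ $$V_{12}V_{12}^*V_{23}=V_{23}V_{12}V_{12}^*,\qquad V_{12}V_{23}^*V_{23}=V_{23}^*V_{23}V_{12}.$$ -/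

import Mathlib

open scoped TensorProduct ComplexOrder

/-! ### Faithful positive functionals on a finite-dimensional C*-algebra -/

section Functional

/-- A positive linear functional is faithful if it vanishes on no nonzero `x* x`. -/
def IsFaithfulFunctional {N : Type*} [CStarAlgebra N] [PartialOrder N] [StarOrderedRing N]
    (ν : N →ₚ[ℂ] ℂ) : Prop :=
  ∀ x : N, ν (star x * x) = 0 → x = 0

/-- The bilinear form `(x, y) ↦ ν (x y)`. -/
noncomputable def functionalForm {N : Type*} [CStarAlgebra N] [PartialOrder N] [StarOrderedRing N]
    (ν : N →ₚ[ℂ] ℂ) : LinearMap.BilinForm ℂ N :=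
  (LinearMap.mul ℂ N).compr₂ ν.toLinearMap

theorem functionalForm_apply {N : Type*} [CStarAlgebra N] [PartialOrder N] [StarOrderedRing N]
    (ν : N →ₚ[ℂ] ℂ) (x y : N) : functionalForm ν x y = ν (x * y) := rfl

theorem functionalForm_nondegenerate {N : Type*} [CStarAlgebra N] [PartialOrder N]
    [StarOrderedRing N] (ν : N →ₚ[ℂ] ℂ) (hν : IsFaithfulFunctional ν) :
    (functionalForm ν).Nondegenerate := by
  constructor
  · intro x hx
    have h := hν (star x) (by simpa [functionalForm_apply] using hx (star x))
    simpa using h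
  · intro x hx
    exact hν x (by simpa [functionalForm_apply] using hx (star x))

/-- `g` is a positive invertible element implementing the modular automorphism
`θ x = g x g⁻¹` of `ν`, which is determined by `ν (x y) = ν (y θ(x))`. -/
def IsModularElement {N : Type*} [CStarAlgebra N] [PartialOrder N] [StarOrderedRing N]
    (ν : N →ₚ[ℂ] ℂ) (g : N) : Prop :=
  0 ≤ g ∧ IsUnit g ∧ ∀ x y : N, ν (x * y) = ν (y * (g * x * Ring.inverse g))

/-! The next facts show that a modular element exists: it is the density of `ν` with respect to
the trace of the regular representation. -/

theorem isUnit_of_mul_eq_zero {N : Type*} [CStarAlgebra N] [FiniteDimensional ℂ N] {b : N}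
    (hb : ∀ y : N, b * y = 0 → y = 0) : IsUnit b := by
  have hinj : Function.Injective (LinearMap.mulLeft ℂ b) := by
    rw [← LinearMap.ker_eq_bot, LinearMap.ker_eq_bot']
    intro y hy
    exact hb y (by simpa using hy)
  obtain ⟨c, hc⟩ := (LinearMap.injective_iff_surjective.mp hinj) 1
  have hc : b * c = 1 := by simpa using hc
  refine ⟨⟨b, c, hc, ?_⟩, rfl⟩
  have : b * (c * b - 1) = 0 := by rw [mul_sub, ← mul_assoc, hc]; simp
  exact sub_eq_zero.mp (hb _ this)

/-- The trace of the left regular representation. -/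
noncomputable def regTrace (N : Type*) [CStarAlgebra N] : N →ₗ[ℂ] ℂ :=
  LinearMap.trace ℂ N ∘ₗ (Algebra.lmul ℂ N).toLinearMap

theorem regTrace_comm {N : Type*} [CStarAlgebra N] (x y : N) :
    regTrace N (x * y) = regTrace N (y * x) := by
  simp only [regTrace, LinearMap.comp_apply, AlgHom.toLinearMap_apply, map_mul]
  exact LinearMap.trace_mul_comm ℂ _ _

theorem spectrum_lmul {N : Type*} [CStarAlgebra N] [FiniteDimensional ℂ N] (a : N) :
    spectrum ℂ (Algebra.lmul ℂ N a) = spectrum ℂ a := by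
  apply subset_antisymm
  · exact AlgHom.spectrum_apply_subset (Algebra.lmul ℂ N) a
  · intro r hr
    rw [spectrum.mem_iff] at hr ⊢
    contrapose! hr
    rw [← AlgHom.commutes (Algebra.lmul ℂ N), ← map_sub] at hr
    apply isUnit_of_mul_eq_zero
    intro y hy
    have hi := ((Module.End.isUnit_iff _).mp hr).injective
    apply hi
    rw [map_zero]
    exact hy

theorem regTrace_eq {N : Type*} [CStarAlgebra N] [FiniteDimensional ℂ N] (a : N) :
    regTrace N a = (LinearMap.charpoly (Algebra.lmul ℂ N a)).roots.sum := by
  let b := Module.finBasis ℂ N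
  simp only [regTrace, LinearMap.comp_apply, AlgHom.toLinearMap_apply]
  rw [LinearMap.trace_eq_matrix_trace ℂ b, Matrix.trace_eq_sum_roots_charpoly,
    LinearMap.charpoly_toMatrix]

theorem mem_roots_charpoly_lmul {N : Type*} [CStarAlgebra N] [FiniteDimensional ℂ N]
    (a : N) (r : ℂ) :
    r ∈ (LinearMap.charpoly (Algebra.lmul ℂ N a)).roots ↔ r ∈ spectrum ℂ a := by
  rw [Polynomial.mem_roots (LinearMap.charpoly_monic _).ne_zero,
    ← Module.End.hasEigenvalue_iff_isRoot_charpoly, Module.End.hasEigenvalue_iff_mem_spectrum,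
    spectrum_lmul]

theorem regTrace_nonneg {N : Type*} [CStarAlgebra N] [PartialOrder N] [StarOrderedRing N]
    [FiniteDimensional ℂ N] {a : N} (ha : 0 ≤ a) : 0 ≤ regTrace N a := by
  rw [regTrace_eq]
  exact Multiset.sum_nonneg fun r hr =>
    spectrum_nonneg_of_nonneg ha ((mem_roots_charpoly_lmul a r).mp hr)

theorem eq_zero_of_regTrace {N : Type*} [CStarAlgebra N] [PartialOrder N] [StarOrderedRing N]
    [FiniteDimensional ℂ N] {a : N} (ha : 0 ≤ a) (h : regTrace N a = 0) : a = 0 := by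
  rw [regTrace_eq] at h
  have h0 := Multiset.all_zero_of_le_zero_le_of_sum_eq_zero
    (fun r hr => spectrum_nonneg_of_nonneg ha ((mem_roots_charpoly_lmul a r).mp hr)) h
  apply CFC.eq_zero_of_spectrum_subset_zero (R := ℂ) (p := IsStarNormal) a
  intro r hr
  exact h0 _ ((mem_roots_charpoly_lmul a r).mpr hr)

theorem regTrace_star {N : Type*} [CStarAlgebra N] [PartialOrder N] [StarOrderedRing N]
    [FiniteDimensional ℂ N] (a : N) : regTrace N (star a) = star (regTrace N a) := by
  let τ : N →ₚ[ℂ] ℂ := ⟨regTrace N, by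
    intro x y hxy
    have := regTrace_nonneg (sub_nonneg.mpr hxy)
    rw [map_sub] at this
    exact sub_nonneg.mp this⟩
  exact map_star τ a

theorem exists_isModularElement {N : Type*} [CStarAlgebra N] [PartialOrder N] [StarOrderedRing N]
    [FiniteDimensional ℂ N] (ν : N →ₚ[ℂ] ℂ) (hν : IsFaithfulFunctional ν) :
    ∃ g : N, IsModularElement ν g := by
  let B : LinearMap.BilinForm ℂ N := (LinearMap.mul ℂ N).compr₂ (regTrace N)
  have hBa : ∀ x y, B x y = regTrace N (x * y) := fun _ _ => rfl
  have hB : B.Nondegenerate := by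
    constructor
    · intro x hx
      have h := hx (star x)
      rw [hBa] at h
      simpa using eq_zero_of_regTrace (mul_star_self_nonneg x) h
    · intro x hx
      have h := hx (star x)
      rw [hBa] at h
      simpa using eq_zero_of_regTrace (star_mul_self_nonneg x) h
  let d : N := (B.toDual hB).symm ν.toLinearMap
  have hd : ∀ x, regTrace N (d * x) = ν x := by
    intro x
    rw [← hBa]
    exact LinearMap.BilinForm.apply_toDual_symm_apply (B := B) (hB := hB) ν.toLinearMap x
  have hsa : IsSelfAdjoint d := by
    have h0 : ∀ x, B (star d - d) x = 0 := by
      intro x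
      rw [hBa, sub_mul, map_sub, hd]
      have h1 : star d * x = star (star x * d) := by simp
      rw [h1, regTrace_star, regTrace_comm, hd, map_star ν, star_star, sub_self]
    exact sub_eq_zero.mp (hB.1 _ h0)
  have hneg : d⁻ = 0 := by
    have h1 : d * d⁻ = -(d⁻ * d⁻) := by
      calc d * d⁻ = (d⁺ - d⁻) * d⁻ := by rw [CFC.posPart_sub_negPart d hsa]
        _ = -(d⁻ * d⁻) := by rw [sub_mul, CFC.posPart_mul_negPart, zero_sub]
    have h2 : 0 ≤ ν (d⁻) := map_nonneg ν (CFC.negPart_nonneg d)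
    have hs : star d⁻ = d⁻ := (IsSelfAdjoint.of_nonneg (CFC.negPart_nonneg d)).star_eq
    have h3 : 0 ≤ star d⁻ * d⁻ := star_mul_self_nonneg _
    have h4 : regTrace N (star d⁻ * d⁻) = 0 := by
      have h5 := regTrace_nonneg h3
      rw [← hd, h1, map_neg] at h2
      rw [hs] at h5 ⊢
      exact le_antisymm (by simpa using h2) h5
    simpa using eq_zero_of_regTrace h3 h4
  have hpos : 0 ≤ d := by
    rw [← CFC.posPart_sub_negPart d hsa, hneg, sub_zero]
    exact CFC.posPart_nonneg d
  have hunit : IsUnit d := by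
    apply isUnit_of_mul_eq_zero
    intro y hy
    have h1 : ν (star (star y) * star y) = 0 := by
      rw [star_star, ← hd, ← mul_assoc, hy, zero_mul, map_zero]
    simpa using hν _ h1
  refine ⟨d, hpos, hunit, fun x y => ?_⟩
  have h1 : d * (y * (d * x * Ring.inverse d)) = (d * (y * (d * x))) * Ring.inverse d := by
    simp only [mul_assoc]
  rw [← hd, ← hd, h1, regTrace_comm _ (Ring.inverse d), ← mul_assoc (Ring.inverse d),
    Ring.inverse_mul_cancel d hunit, one_mul, ← mul_assoc, regTrace_comm (d * x) y]

/-- A positive element implementing the modular automorphism. It is unique up to a positive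
invertible central factor, which does not affect `halfModular` below. -/
noncomputable def modularElement {N : Type*} [CStarAlgebra N] [PartialOrder N] [StarOrderedRing N]
    [FiniteDimensional ℂ N] (ν : N →ₚ[ℂ] ℂ) (hν : IsFaithfulFunctional ν) : N :=
  (exists_isModularElement ν hν).choose

/-- `θ^{1/2} x = g^{1/2} x g^{-1/2}`, the square root of the modular automorphism. -/
noncomputable def halfModular {N : Type*} [CStarAlgebra N] [PartialOrder N] [StarOrderedRing N]
    [FiniteDimensional ℂ N] (ν : N →ₚ[ℂ] ℂ) (hν : IsFaithfulFunctional ν) (x : N) : N :=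
  modularElement ν hν ^ (1 / 2 : ℝ) * x * modularElement ν hν ^ (-(1 / 2) : ℝ)

/-- A basis `(a_i)` of `N`. -/
noncomputable def quasiBasisA (N : Type*) [CStarAlgebra N] [FiniteDimensional ℂ N] :
    Module.Basis (Fin (Module.finrank ℂ N)) ℂ N :=
  Module.finBasis ℂ N

/-- The dual basis `(b_i)`, characterised by `ν (b_i a_j) = δ_{ij}`. -/
noncomputable def quasiBasisB {N : Type*} [CStarAlgebra N] [PartialOrder N] [StarOrderedRing N]
    [FiniteDimensional ℂ N] (ν : N →ₚ[ℂ] ℂ) (hν : IsFaithfulFunctional ν) :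
    Module.Basis (Fin (Module.finrank ℂ N)) ℂ N :=
  (functionalForm ν).dualBasis (functionalForm_nondegenerate ν hν) (quasiBasisA N)

theorem quasiBasis_dual {N : Type*} [CStarAlgebra N] [PartialOrder N] [StarOrderedRing N]
    [FiniteDimensional ℂ N] (ν : N →ₚ[ℂ] ℂ) (hν : IsFaithfulFunctional ν)
    (i j : Fin (Module.finrank ℂ N)) :
    ν (quasiBasisB ν hν i * quasiBasisA N j) = if j = i then 1 else 0 :=
  LinearMap.BilinForm.apply_dualBasis_left (functionalForm_nondegenerate ν hν) (quasiBasisA N) i j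

/-- The index `∑ a_i b_i` of `ν`; it does not depend on the basis. -/
noncomputable def functionalIndex {N : Type*} [CStarAlgebra N] [PartialOrder N] [StarOrderedRing N]
    [FiniteDimensional ℂ N] (ν : N →ₚ[ℂ] ℂ) (hν : IsFaithfulFunctional ν) : N :=
  ∑ i, quasiBasisA N i * quasiBasisB ν hν i

/-- `u_i = λ⁻¹ a_i`, with `λ` the index. Together with `v_i` this is the idempotent
`e_ν = ∑ u_i ⊗ v_i ∈ Nᵒ ⊗ N`. -/
noncomputable def relU {N : Type*} [CStarAlgebra N] [PartialOrder N] [StarOrderedRing N]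
    [FiniteDimensional ℂ N] (ν : N →ₚ[ℂ] ℂ) (hν : IsFaithfulFunctional ν)
    (i : Fin (Module.finrank ℂ N)) : N :=
  Ring.inverse (functionalIndex ν hν) * quasiBasisA N i

/-- `v_i = θ^{1/2} b_i`. -/
noncomputable def relV {N : Type*} [CStarAlgebra N] [PartialOrder N] [StarOrderedRing N]
    [FiniteDimensional ℂ N] (ν : N →ₚ[ℂ] ℂ) (hν : IsFaithfulFunctional ν)
    (i : Fin (Module.finrank ℂ N)) : N :=
  halfModular ν hν (quasiBasisB ν hν i)

end Functional

/-! ### Relative tensor products -/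

section RelativeTensor

/-- `E = (α ⊗ β)(e_ν)`, for a right action `α` on `H` and a left action `β` on `K`. Its range is the
relative tensor product of `H_α` and `_βK` over `ν`. -/
noncomputable def relProj {N : Type*} [CStarAlgebra N] [PartialOrder N] [StarOrderedRing N]
    [FiniteDimensional ℂ N] (ν : N →ₚ[ℂ] ℂ) (hν : IsFaithfulFunctional ν)
    {H K : Type*} [NormedAddCommGroup H] [InnerProductSpace ℂ H] [FiniteDimensional ℂ H]
    [NormedAddCommGroup K] [InnerProductSpace ℂ K] [FiniteDimensional ℂ K]
    (α : Nᵐᵒᵖ →⋆ₙₐ[ℂ] Module.End ℂ H) (β : N →⋆ₙₐ[ℂ] Module.End ℂ K) :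
    Module.End ℂ (H ⊗[ℂ] K) :=
  ∑ i, TensorProduct.map (α (MulOpposite.op (relU ν hν i))) (β (relV ν hν i))

/-- `Ê = (γ ⊗ α)(e_ν)`, for a left action `γ` on `K` and a right action `α` on `H`. Its range is the
relative tensor product of `K_γ` and `_αH` over the opposite functional `νᵒ` on `Nᵒ`. -/
noncomputable def relProjOp {N : Type*} [CStarAlgebra N] [PartialOrder N] [StarOrderedRing N]
    [FiniteDimensional ℂ N] (ν : N →ₚ[ℂ] ℂ) (hν : IsFaithfulFunctional ν)
    {K H : Type*} [NormedAddCommGroup K] [InnerProductSpace ℂ K] [FiniteDimensional ℂ K]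
    [NormedAddCommGroup H] [InnerProductSpace ℂ H] [FiniteDimensional ℂ H]
    (γ : N →⋆ₙₐ[ℂ] Module.End ℂ K) (α : Nᵐᵒᵖ →⋆ₙₐ[ℂ] Module.End ℂ H) :
    Module.End ℂ (K ⊗[ℂ] H) :=
  ∑ i, TensorProduct.map (γ (relU ν hν i)) (α (MulOpposite.op (relV ν hν i)))

end RelativeTensor

/-! ### Operators on threefold tensor products -/

section Legs

/-- `ξ ⊗ η ⊗ ζ ↦ η ⊗ ξ ⊗ ζ`. -/
noncomputable def flip12 (H : Type*) [NormedAddCommGroup H] [InnerProductSpace ℂ H] :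
    Module.End ℂ ((H ⊗[ℂ] H) ⊗[ℂ] H) :=
  (TensorProduct.comm ℂ H H).toLinearMap.rTensor H

/-- `ξ ⊗ η ⊗ ζ ↦ ξ ⊗ ζ ⊗ η`. -/
noncomputable def flip23 (H : Type*) [NormedAddCommGroup H] [InnerProductSpace ℂ H] :
    Module.End ℂ ((H ⊗[ℂ] H) ⊗[ℂ] H) :=
  (TensorProduct.rightComm ℂ H H H).toLinearMap

/-- `Σ_{12,3} : ξ ⊗ η ⊗ ζ ↦ ζ ⊗ ξ ⊗ η`. -/
noncomputable def cycle (H : Type*) [NormedAddCommGroup H] [InnerProductSpace ℂ H] :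
    Module.End ℂ ((H ⊗[ℂ] H) ⊗[ℂ] H) :=
  (TensorProduct.assoc ℂ H H H).symm.toLinearMap ∘ₗ
    (TensorProduct.comm ℂ (H ⊗[ℂ] H) H).toLinearMap

/-- `X ⊗ 1`. -/
noncomputable def leg12 {H : Type*} [NormedAddCommGroup H] [InnerProductSpace ℂ H]
    (X : Module.End ℂ (H ⊗[ℂ] H)) : Module.End ℂ ((H ⊗[ℂ] H) ⊗[ℂ] H) :=
  X.rTensor H

/-- `1 ⊗ X`. -/
noncomputable def leg23 {H : Type*} [NormedAddCommGroup H] [InnerProductSpace ℂ H]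
    (X : Module.End ℂ (H ⊗[ℂ] H)) : Module.End ℂ ((H ⊗[ℂ] H) ⊗[ℂ] H) :=
  (TensorProduct.assoc ℂ H H H).symm.toLinearMap ∘ₗ X.lTensor H ∘ₗ
    (TensorProduct.assoc ℂ H H H).toLinearMap

/-- `X` acting on the factors 1 and 3. -/
noncomputable def leg13 {H : Type*} [NormedAddCommGroup H] [InnerProductSpace ℂ H]
    (X : Module.End ℂ (H ⊗[ℂ] H)) : Module.End ℂ ((H ⊗[ℂ] H) ⊗[ℂ] H) :=
  flip23 H * leg12 X * flip23 H

/-- `X` with its first leg in factor 2 and its second leg in factor 1. -/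
noncomputable def leg21 {H : Type*} [NormedAddCommGroup H] [InnerProductSpace ℂ H]
    (X : Module.End ℂ (H ⊗[ℂ] H)) : Module.End ℂ ((H ⊗[ℂ] H) ⊗[ℂ] H) :=
  flip12 H * leg12 X * flip12 H

/-- `X` with its first leg in factor 3 and its second leg in factor 2. -/
noncomputable def leg32 {H : Type*} [NormedAddCommGroup H] [InnerProductSpace ℂ H]
    (X : Module.End ℂ (H ⊗[ℂ] H)) : Module.End ℂ ((H ⊗[ℂ] H) ⊗[ℂ] H) :=
  flip23 H * leg23 X * flip23 H

/-- Multiplicative partial isometries. Here `star` is the Hilbert space adjoint on `H ⊗ H`, and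
`leg12 (star V) = V₁₂*`, `leg23 (star V) = V₂₃*` are the adjoints of the legs of `V`. -/
structure IsMultiplicativePartialIsometry {H : Type*} [NormedAddCommGroup H]
    [InnerProductSpace ℂ H] [FiniteDimensional ℂ H] (V : Module.End ℂ (H ⊗[ℂ] H)) : Prop where
  partial_isometry : V * star V * V = V
  pentagon : leg23 V * leg12 V = leg12 V * leg13 V * leg23 V
  hexagon₁ : leg13 V * leg23 V * leg23 (star V) = leg12 (star V) * leg12 V * leg13 V
  hexagon₂ : leg12 V * leg12 (star V) * leg23 V = leg23 V * leg12 V * leg12 (star V)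
  hexagon₃ : leg12 V * leg23 (star V) * leg23 V = leg23 (star V) * leg23 V * leg12 V

end Legs

/-! ### Pseudo-multiplicative isometries -/

section Pseudo

/-- The map `P T → Q T` obtained from an operator `X` on `T`. When `P`, `Q` are projections and
`X` maps the range of `P` into that of `Q`, it is the restriction of `X` (`arrow_apply`). -/
noncomputable def arrow {T : Type*} [AddCommGroup T] [Module ℂ T] (P Q X : Module.End ℂ T) :
    LinearMap.range P →ₗ[ℂ] LinearMap.range Q :=
  Q.rangeRestrict ∘ₗ X ∘ₗ (LinearMap.range P).subtype

theorem arrow_apply {T : Type*} [AddCommGroup T] [Module ℂ T] {P Q X : Module.End ℂ T}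
    (hQ : Q * Q = Q) (ξ : LinearMap.range P) (h : X ξ ∈ LinearMap.range Q) :
    (arrow P Q X ξ : T) = X ξ := by
  obtain ⟨η, hη⟩ := h
  change Q (X ξ) = X ξ
  rw [← hη]
  exact LinearMap.congr_fun hQ η

/-- The map `U : Ê T → E T` regarded as an operator on `T`, vanishing on the kernel of `Ê`. -/
noncomputable def ambient {T : Type*} [AddCommGroup T] [Module ℂ T] {E Ehat : Module.End ℂ T}
    (U : LinearMap.range Ehat →ₗ[ℂ] LinearMap.range E) : Module.End ℂ T :=
  (LinearMap.range E).subtype ∘ₗ U ∘ₗ Ehat.rangeRestrict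

/-- Let `β`, `α`, `βhat` be actions of `N`, `Nᵒ`, `N` on `H`. A unitary `U` from
`H_βhat ⊗_{νᵒ} _αH = Ê (H ⊗ H)` to `H_α ⊗_ν _βH = E (H ⊗ H)` is pseudo-multiplicative if it
intertwines the four perimeter actions and if the pentagon diagram commutes. The corners of that
diagram are multiple relative tensor products, realised as ranges of products of commuting
projections on `H ⊗ H ⊗ H`; its edges are the restrictions of `U ⊗ 1`, of `1 ⊗ U` and of flips. -/
structure IsPseudoMultiplicative {N : Type*} [CStarAlgebra N] [PartialOrder N]
    [StarOrderedRing N] [FiniteDimensional ℂ N] (ν : N →ₚ[ℂ] ℂ) (hν : IsFaithfulFunctional ν)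
    {H : Type*} [NormedAddCommGroup H] [InnerProductSpace ℂ H] [FiniteDimensional ℂ H]
    (β : N →⋆ₙₐ[ℂ] Module.End ℂ H) (α : Nᵐᵒᵖ →⋆ₙₐ[ℂ] Module.End ℂ H)
    (βhat : N →⋆ₙₐ[ℂ] Module.End ℂ H)
    (U : LinearMap.range (relProjOp ν hν βhat α) ≃ₗᵢ[ℂ] LinearMap.range (relProj ν hν α β)) :
    Prop where
  intertwines_01 : ∀ x : N,
    U.toLinearEquiv.toLinearMap ∘ₗ arrow (relProjOp ν hν βhat α) (relProjOp ν hν βhat α)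
        (TensorProduct.map (β x) LinearMap.id) =
      arrow (relProj ν hν α β) (relProj ν hν α β) (TensorProduct.map (β x) LinearMap.id) ∘ₗ
        U.toLinearEquiv.toLinearMap
  intertwines_12 : ∀ x : N,
    U.toLinearEquiv.toLinearMap ∘ₗ arrow (relProjOp ν hν βhat α) (relProjOp ν hν βhat α)
        (TensorProduct.map LinearMap.id (β x)) =
      arrow (relProj ν hν α β) (relProj ν hν α β) (TensorProduct.map (βhat x) LinearMap.id) ∘ₗ
        U.toLinearEquiv.toLinearMap
  intertwines_23 : ∀ x : N,
    U.toLinearEquiv.toLinearMap ∘ₗ arrow (relProjOp ν hν βhat α) (relProjOp ν hν βhat α)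
        (TensorProduct.map LinearMap.id (βhat x)) =
      arrow (relProj ν hν α β) (relProj ν hν α β) (TensorProduct.map LinearMap.id (βhat x)) ∘ₗ
        U.toLinearEquiv.toLinearMap
  intertwines_03 : ∀ x : Nᵐᵒᵖ,
    U.toLinearEquiv.toLinearMap ∘ₗ arrow (relProjOp ν hν βhat α) (relProjOp ν hν βhat α)
        (TensorProduct.map (α x) LinearMap.id) =
      arrow (relProj ν hν α β) (relProj ν hν α β) (TensorProduct.map LinearMap.id (α x)) ∘ₗ
        U.toLinearEquiv.toLinearMap
  pentagon :
    let E := relProj ν hν α β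
    let Ehat := relProjOp ν hν βhat α
    let W := ambient U.toLinearEquiv.toLinearMap
    arrow (leg12 E * leg23 Ehat) (leg12 E * leg23 E) (leg23 W) ∘ₗ
        arrow (leg12 Ehat * leg23 Ehat) (leg12 E * leg23 Ehat) (leg12 W) =
      arrow (leg13 E * leg12 Ehat) (leg12 E * leg23 E) (leg12 W) ∘ₗ
        arrow (leg21 Ehat * leg23 E) (leg13 E * leg12 Ehat) (flip12 H) ∘ₗ
        arrow (leg13 E * leg23 Ehat) (leg21 Ehat * leg23 E) (leg23 W) ∘ₗ
        arrow (leg12 Ehat * leg32 E) (leg13 E * leg23 Ehat) (cycle H) ∘ₗ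
        arrow (leg13 Ehat * leg23 E) (leg12 Ehat * leg32 E) (flip23 H) ∘ₗ
        arrow (leg12 Ehat * leg23 Ehat) (leg13 Ehat * leg23 E) (leg23 W)

/-- `V = E U Ê`, as an operator on the whole tensor product. -/
noncomputable def extendByProjections {T : Type*} [AddCommGroup T] [Module ℂ T]
    {E Ehat : Module.End ℂ T} (U : LinearMap.range Ehat →ₗ[ℂ] LinearMap.range E) :
    Module.End ℂ T :=
  E ∘ₗ (LinearMap.range E).subtype ∘ₗ U ∘ₗ Ehat.rangeRestrict

end Pseudo

/-!
# Pseudo-multiplicative isometries give multiplicative partial isometries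

Everything is read off the canonical element `e_ν = ∑ a_i ⊗ θ^{1/2}(b_i)`. Since `ν` is faithful,
an element `∑ c_i ⊗ d_i` of `N ⊗ N` is `e_ν` as soon as `∑ ν(y c_i) d_i = θ^{1/2}(y)` for all `y`
(`sum_tmul_eq_canonical`). This criterion, with the twisted symmetry
`ν(x θ^{1/2}(y)) = ν(y θ^{1/2}(x))`, shows that `e_ν` is invariant under the flip (`canonical_swap`)
and under `* ⊗ *` (`canonical_star`), and, the index being one, idempotent in `Nᵒ ⊗ N`
(`canonical_mul_self`). So `E` and `Ê` are orthogonal projections, the adjoint of `E U Ê` is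
`Ê U⁻¹ E`, and `V V* = E`, `V* V = Ê`.

As the three actions commute, the operators in the perimeter relations commute with `E` and `Ê`, and
the relations hold for `V` on all of `H ⊗ H` (`IsPseudoMultiplicative.intertwinesPerimeter`).
Applied in one tensor factor of `H ⊗ H ⊗ H`, they carry the legs of `E` and `Ê` past those of `V`:
`V₁₂ Ê₂₃ = Ê₂₃ V₁₂`, `E₁₂ V₂₃ = V₂₃ E₁₂`, and `V₁₃ E₂₃ = Ê₁₂ V₁₃` by the symmetry of `e_ν`, which are
the three hexagon identities, and also `V₂₃ Ê₁₂ = Ê₁₃ V₂₃` and `V₁₂ E₁₃ = E₂₃ V₁₂`. With these all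
projections in the pentagon diagram are absorbed (`pentagon_of_diagram`), its three flips combine to
the conjugation of `V₂₃` by `Σ_{1,2}`, which is `V₁₃`, and the diagram becomes
`V₂₃ V₁₂ = V₁₂ V₁₃ V₂₃`.
-/

/-! ### The canonical element `∑ a_i ⊗ θ^{1/2}(b_i)` -/

section CanonicalElement

variable {N : Type*} [CStarAlgebra N] [PartialOrder N] [StarOrderedRing N]
  [FiniteDimensional ℂ N] (ν : N →ₚ[ℂ] ℂ) (hν : IsFaithfulFunctional ν)

theorem sum_apply_smul_quasiBasisB (x : N) :
    ∑ i, ν (x * quasiBasisA N i) • quasiBasisB ν hν i = x := by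
  conv_rhs => rw [← (quasiBasisB ν hν).sum_repr x]
  refine Finset.sum_congr rfl fun i _ => ?_
  rw [quasiBasisB, LinearMap.BilinForm.dualBasis_repr_apply, functionalForm_apply]

theorem sum_apply_smul_quasiBasisA (x : N) :
    ∑ i, ν (quasiBasisB ν hν i * x) • quasiBasisA N i = x := by
  conv_rhs => rw [← (quasiBasisA N).sum_repr x]
  refine Finset.sum_congr rfl fun i _ => ?_
  have h : ν (quasiBasisB ν hν i * x) =
      ν (quasiBasisB ν hν i * ∑ j, (quasiBasisA N).repr x j • quasiBasisA N j) := by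
    rw [(quasiBasisA N).sum_repr x]
  rw [h]
  simp [Finset.mul_sum, quasiBasis_dual, -Module.Basis.sum_repr]

/-- The properties of `h = g^{1/2}` and `k = g^{-1/2}` that are used below. The modular automorphism
appears as `θ(x) = h (h x k) k`, which avoids `Ring.inverse`. -/
theorem exists_halfModular_eq : ∃ h k : N, h * k = 1 ∧ k * h = 1 ∧ star h = h ∧ star k = k ∧
    (∀ x, halfModular ν hν x = h * x * k) ∧
    ∀ x y, ν (x * y) = ν (y * (h * (h * x * k) * k)) := by
  obtain ⟨h0, hu, hmod⟩ : IsModularElement ν (modularElement ν hν) :=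
    (exists_isModularElement ν hν).choose_spec
  set g := modularElement ν hν with hg
  have hhk : g ^ (1 / 2 : ℝ) * g ^ (-(1 / 2) : ℝ) = 1 := by
    rw [← CFC.rpow_add hu, add_neg_cancel, CFC.rpow_zero _ h0]
  have hkh : g ^ (-(1 / 2) : ℝ) * g ^ (1 / 2 : ℝ) = 1 := by
    rw [← CFC.rpow_add hu, neg_add_cancel, CFC.rpow_zero _ h0]
  have hh : g ^ (1 / 2 : ℝ) * g ^ (1 / 2 : ℝ) = g := by
    rw [← CFC.rpow_add hu, add_halves, CFC.rpow_one _ h0]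
  have hkk : g ^ (-(1 / 2) : ℝ) * g ^ (-(1 / 2) : ℝ) = Ring.inverse g := by
    refine (left_inv_eq_right_inv (Ring.inverse_mul_cancel g hu) ?_).symm
    nth_rw 1 [← hh]
    rw [mul_assoc, ← mul_assoc _ (_ ^ (-(1 / 2) : ℝ)), hhk, one_mul, hhk]
  refine ⟨g ^ (1 / 2 : ℝ), g ^ (-(1 / 2) : ℝ), hhk, hkh,
    (IsSelfAdjoint.of_nonneg CFC.rpow_nonneg).star_eq,
    (IsSelfAdjoint.of_nonneg CFC.rpow_nonneg).star_eq, fun _ => rfl, fun x y => ?_⟩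
  rw [hmod x y, ← hkk]
  congr 2
  nth_rw 1 [← hh]
  simp only [mul_assoc]

/-- `ν` is invariant under `θ^{1/2}`. -/
theorem apply_halfModular (x : N) : ν (halfModular ν hν x) = ν x := by
  obtain ⟨h, k, hhk, hkh, -, -, hθ, hν'⟩ := exists_halfModular_eq ν hν
  have h1 := hν' x 1
  rw [mul_one, one_mul] at h1
  rw [hθ, hν' (h * x) k, h1]
  congr 1
  calc k * (h * (h * (h * x) * k) * k) = (k * h) * (h * (h * x) * k) * k := by
        simp only [mul_assoc]
    _ = h * (h * x * k) * k := by rw [hkh, one_mul]; simp only [mul_assoc]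

/-- The twisted symmetry of `ν`: moving `x` to the other side of `ν` costs `θ`, shared equally
between the two factors. -/
theorem apply_mul_halfModular (x y : N) :
    ν (x * halfModular ν hν y) = ν (y * halfModular ν hν x) := by
  obtain ⟨h, k, hhk, hkh, -, -, hθ, hν'⟩ := exists_halfModular_eq ν hν
  rw [hν' x, ← apply_halfModular ν hν (y * halfModular ν hν x)]
  simp only [hθ]
  congr 1
  calc h * y * k * (h * (h * x * k) * k) = h * y * (k * h) * (h * x * k) * k := by
        simp only [mul_assoc]
    _ = h * (y * (h * x * k)) * k := by rw [hkh, mul_one]; simp only [mul_assoc]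

theorem halfModular_mul (x y : N) :
    halfModular ν hν (x * y) = halfModular ν hν x * halfModular ν hν y := by
  obtain ⟨h, k, hhk, hkh, -, -, hθ, hν'⟩ := exists_halfModular_eq ν hν
  simp only [hθ]
  calc h * (x * y) * k = h * x * 1 * y * k := by simp only [mul_assoc, one_mul]
    _ = h * x * k * (h * y * k) := by rw [← hkh]; simp only [mul_assoc]

theorem halfModular_sum_smul {ι : Type*} (s : Finset ι) (c : ι → ℂ) (x : ι → N) :
    halfModular ν hν (∑ i ∈ s, c i • x i) = ∑ i ∈ s, c i • halfModular ν hν (x i) := by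
  simp only [halfModular, Finset.mul_sum, Finset.sum_mul, mul_smul_comm, smul_mul_assoc]

theorem halfModular_surjective : Function.Surjective (halfModular ν hν) := by
  obtain ⟨h, k, hhk, hkh, -, -, hθ, hν'⟩ := exists_halfModular_eq ν hν
  refine fun y => ⟨k * y * h, ?_⟩
  calc halfModular ν hν (k * y * h) = (h * k) * y * (h * k) := by rw [hθ]; simp only [mul_assoc]
    _ = y := by rw [hhk, one_mul, mul_one]

theorem halfModular_star_halfModular (x : N) :
    halfModular ν hν (star (halfModular ν hν x)) = star x := by
  obtain ⟨h, k, hhk, hkh, hh, hk, hθ, hν'⟩ := exists_halfModular_eq ν hν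
  simp only [hθ, star_mul, hh, hk]
  calc h * (k * (star x * h)) * k = (h * k) * star x * (h * k) := by simp only [mul_assoc]
    _ = star x := by rw [hhk, one_mul, mul_one]

theorem sum_apply_smul_relV (y : N) :
    ∑ i, ν (y * quasiBasisA N i) • relV ν hν i = halfModular ν hν y := by
  conv_rhs => rw [← sum_apply_smul_quasiBasisB ν hν y]
  rw [halfModular_sum_smul]
  rfl

/-- Nondegeneracy of `ν` determines the canonical element by its contractions
`(ν(y ·) ⊗ id)(e_ν) = θ^{1/2}(y)`. -/
theorem sum_tmul_eq_canonical {ι : Type*} [Fintype ι] (c d : ι → N)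
    (hcd : ∀ y, ∑ i, ν (y * c i) • d i = halfModular ν hν y) :
    ∑ i, c i ⊗ₜ[ℂ] d i = ∑ i, quasiBasisA N i ⊗ₜ[ℂ] relV ν hν i := by
  calc ∑ i, c i ⊗ₜ[ℂ] d i
      = ∑ i, (∑ j, ν (quasiBasisB ν hν j * c i) • quasiBasisA N j) ⊗ₜ[ℂ] d i := by
        simp only [sum_apply_smul_quasiBasisA]
    _ = ∑ j, quasiBasisA N j ⊗ₜ[ℂ] ∑ i, ν (quasiBasisB ν hν j * c i) • d i := by
        simp only [TensorProduct.sum_tmul, TensorProduct.tmul_sum, TensorProduct.smul_tmul]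
        exact Finset.sum_comm
    _ = _ := by simp only [hcd, relV]

theorem canonical_swap :
    ∑ i, relV ν hν i ⊗ₜ[ℂ] quasiBasisA N i = ∑ i, quasiBasisA N i ⊗ₜ[ℂ] relV ν hν i := by
  refine sum_tmul_eq_canonical ν hν _ _ fun y => ?_
  simp only [relV, apply_mul_halfModular ν hν y]
  exact sum_apply_smul_quasiBasisA ν hν _

theorem canonical_star :
    ∑ i, star (quasiBasisA N i) ⊗ₜ[ℂ] star (relV ν hν i) =
      ∑ i, quasiBasisA N i ⊗ₜ[ℂ] relV ν hν i := by
  refine sum_tmul_eq_canonical ν hν _ _ fun y => ?_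
  obtain ⟨w, hw⟩ := halfModular_surjective ν hν (star (halfModular ν hν y))
  have hy : star y = halfModular ν hν (halfModular ν hν w) := by
    rw [hw, halfModular_star_halfModular]
  have key : ∀ i, ν (y * star (quasiBasisA N i)) = star (ν (w * quasiBasisA N i)) := by
    intro i
    rw [← star_star (y * _), map_star ν, star_mul, star_star, hy, apply_mul_halfModular,
      ← halfModular_mul, apply_halfModular]
  simp only [key, ← star_smul, ← star_sum, sum_apply_smul_relV, hw, star_star]

/-- For index one the canonical element is an idempotent of `Nᵒ ⊗ N`. -/
theorem canonical_mul_self (hindex : functionalIndex ν hν = 1) :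
    ∑ p : Fin (Module.finrank ℂ N) × Fin (Module.finrank ℂ N),
        (quasiBasisA N p.2 * quasiBasisA N p.1) ⊗ₜ[ℂ] (relV ν hν p.1 * relV ν hν p.2) =
      ∑ i, quasiBasisA N i ⊗ₜ[ℂ] relV ν hν i := by
  refine sum_tmul_eq_canonical ν hν _ _ fun y => ?_
  rw [Fintype.sum_prod_type_right]
  calc ∑ j, ∑ i, ν (y * (quasiBasisA N j * quasiBasisA N i)) • (relV ν hν i * relV ν hν j)
      = ∑ j, halfModular ν hν (y * (quasiBasisA N j * quasiBasisB ν hν j)) := by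
        refine Finset.sum_congr rfl fun j _ => ?_
        simp only [← mul_assoc, ← smul_mul_assoc]
        rw [← Finset.sum_mul, sum_apply_smul_relV, halfModular_mul ν hν _ (quasiBasisB ν hν j)]
        rfl
    _ = halfModular ν hν (y * functionalIndex ν hν) := by
        simp only [functionalIndex, halfModular, Finset.mul_sum, Finset.sum_mul]
    _ = halfModular ν hν y := by rw [hindex, mul_one]

theorem relU_eq (hindex : functionalIndex ν hν = 1) (i : Fin (Module.finrank ℂ N)) :
    relU ν hν i = quasiBasisA N i := by
  rw [relU, hindex, Ring.inverse_one, one_mul]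

end CanonicalElement

/-! ### The projections `E` and `Ê` -/

section Projections

/-- An identity between elements of `N ⊗ N` gives one between their images under a bilinear map. -/
theorem sum_bilinear_congr {N M : Type*} [AddCommGroup N] [Module ℂ N]
    [AddCommGroup M] [Module ℂ M]
    (Φ : N →ₗ[ℂ] N →ₗ[ℂ] M) {ι κ : Type*} [Fintype ι] [Fintype κ] {c d : ι → N} {c' d' : κ → N}
    (h : ∑ i, c i ⊗ₜ[ℂ] d i = ∑ i, c' i ⊗ₜ[ℂ] d' i) :
    ∑ i, Φ (c i) (d i) = ∑ i, Φ (c' i) (d' i) := by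
  simpa only [map_sum, TensorProduct.lift.tmul] using congrArg (TensorProduct.lift Φ) h

variable {N : Type*} [CStarAlgebra N] [PartialOrder N] [StarOrderedRing N]
  [FiniteDimensional ℂ N] (ν : N →ₚ[ℂ] ℂ) (hν : IsFaithfulFunctional ν)
  {H K : Type*} [NormedAddCommGroup H] [InnerProductSpace ℂ H] [FiniteDimensional ℂ H]
  [NormedAddCommGroup K] [InnerProductSpace ℂ K] [FiniteDimensional ℂ K]

/-- The linear map `x ↦ α(xᵒ)` underlying an action of the opposite algebra. -/
noncomputable def opLinear (α : Nᵐᵒᵖ →⋆ₙₐ[ℂ] Module.End ℂ H) : N →ₗ[ℂ] Module.End ℂ H where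
  toFun x := α (MulOpposite.op x)
  map_add' x y := by rw [MulOpposite.op_add, map_add]
  map_smul' c x := by rw [MulOpposite.op_smul, map_smul, RingHom.id_apply]

/-- The linear map underlying an action. -/
noncomputable def actLinear (β : N →⋆ₙₐ[ℂ] Module.End ℂ H) : N →ₗ[ℂ] Module.End ℂ H where
  toFun x := β x
  map_add' := map_add β
  map_smul' := map_smul β

/-- The bilinear map `(x, y) ↦ S x ⊗ T y`. -/
noncomputable def tensorBilinear (S : N →ₗ[ℂ] Module.End ℂ H) (T : N →ₗ[ℂ] Module.End ℂ K) :
    N →ₗ[ℂ] N →ₗ[ℂ] Module.End ℂ (H ⊗[ℂ] K) :=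
  LinearMap.mk₂ ℂ (fun x y => TensorProduct.map (S x) (T y))
    (fun x y z => by rw [map_add, TensorProduct.map_add_left])
    (fun c x y => by rw [map_smul, TensorProduct.map_smul_left])
    (fun x y z => by rw [map_add, TensorProduct.map_add_right])
    (fun c x y => by rw [map_smul, TensorProduct.map_smul_right])

variable (α : Nᵐᵒᵖ →⋆ₙₐ[ℂ] Module.End ℂ H) (β : N →⋆ₙₐ[ℂ] Module.End ℂ K)

/-- `E` and `Ê` have the same form, up to exchanging the two factors, because the canonical element
is symmetric. -/
theorem relProjOp_eq (hindex : functionalIndex ν hν = 1) :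
    relProjOp ν hν β α = ∑ i, TensorProduct.map (β (relV ν hν i))
      (α (MulOpposite.op (quasiBasisA N i))) := by
  simp only [relProjOp, relU_eq ν hν hindex]
  exact sum_bilinear_congr (tensorBilinear (actLinear β) (opLinear α)) (canonical_swap ν hν).symm

theorem relProj_eq (hindex : functionalIndex ν hν = 1) :
    relProj ν hν α β = ∑ i, TensorProduct.map (α (MulOpposite.op (quasiBasisA N i)))
      (β (relV ν hν i)) := by
  simp only [relProj, relU_eq ν hν hindex]

theorem relProj_mul_self (hindex : functionalIndex ν hν = 1) :
    relProj ν hν α β * relProj ν hν α β = relProj ν hν α β := by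
  rw [relProj_eq ν hν α β hindex, Finset.sum_mul_sum, ← Fintype.sum_prod_type']
  refine Eq.trans (Finset.sum_congr rfl fun p _ => ?_)
    (sum_bilinear_congr (tensorBilinear (opLinear α) (actLinear β))
      (canonical_mul_self ν hν hindex))
  rw [← TensorProduct.map_mul, ← map_mul, ← map_mul, ← MulOpposite.op_mul]
  rfl

theorem star_relProj (hindex : functionalIndex ν hν = 1) :
    star (relProj ν hν α β) = relProj ν hν α β := by
  rw [relProj_eq ν hν α β hindex, LinearMap.star_eq_adjoint, map_sum]
  refine Eq.trans (Finset.sum_congr rfl fun p _ => ?_)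
    (sum_bilinear_congr (tensorBilinear (opLinear α) (actLinear β)) (canonical_star ν hν))
  rw [TensorProduct.adjoint_map, ← LinearMap.star_eq_adjoint,
    ← LinearMap.star_eq_adjoint, ← map_star, ← map_star, ← MulOpposite.op_star]
  rfl

theorem relProjOp_mul_self (hindex : functionalIndex ν hν = 1) :
    relProjOp ν hν β α * relProjOp ν hν β α = relProjOp ν hν β α := by
  rw [relProjOp_eq ν hν α β hindex, Finset.sum_mul_sum, ← Fintype.sum_prod_type']
  refine Eq.trans (Finset.sum_congr rfl fun p _ => ?_)
    (sum_bilinear_congr (tensorBilinear (actLinear β) (opLinear α)).flip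
      (canonical_mul_self ν hν hindex))
  rw [← TensorProduct.map_mul, ← map_mul, ← map_mul, ← MulOpposite.op_mul]
  rfl

theorem star_relProjOp (hindex : functionalIndex ν hν = 1) :
    star (relProjOp ν hν β α) = relProjOp ν hν β α := by
  rw [relProjOp_eq ν hν α β hindex, LinearMap.star_eq_adjoint, map_sum]
  refine Eq.trans (Finset.sum_congr rfl fun p _ => ?_)
    (sum_bilinear_congr (tensorBilinear (actLinear β) (opLinear α)).flip (canonical_star ν hν))
  rw [TensorProduct.adjoint_map, ← LinearMap.star_eq_adjoint,
    ← LinearMap.star_eq_adjoint, ← map_star, ← map_star, ← MulOpposite.op_star]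
  rfl

end Projections

/-! ### Leg calculus on `H ⊗ H ⊗ H` -/

section LegCalculus

variable {H : Type*} [NormedAddCommGroup H] [InnerProductSpace ℂ H]

/-- `f ⊗ 1 ⊗ 1`. -/
noncomputable def slot1 (f : Module.End ℂ H) : Module.End ℂ ((H ⊗[ℂ] H) ⊗[ℂ] H) :=
  TensorProduct.map (TensorProduct.map f LinearMap.id) LinearMap.id

/-- `1 ⊗ f ⊗ 1`. -/
noncomputable def slot2 (f : Module.End ℂ H) : Module.End ℂ ((H ⊗[ℂ] H) ⊗[ℂ] H) :=
  TensorProduct.map (TensorProduct.map LinearMap.id f) LinearMap.id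

/-- `1 ⊗ 1 ⊗ f`. -/
noncomputable def slot3 (f : Module.End ℂ H) : Module.End ℂ ((H ⊗[ℂ] H) ⊗[ℂ] H) :=
  TensorProduct.map LinearMap.id f

theorem leg12_mul (X Y : Module.End ℂ (H ⊗[ℂ] H)) : leg12 (X * Y) = leg12 X * leg12 Y :=
  LinearMap.rTensor_mul H X Y

theorem leg23_mul (X Y : Module.End ℂ (H ⊗[ℂ] H)) : leg23 (X * Y) = leg23 X * leg23 Y := by
  refine LinearMap.ext fun ξ => ?_
  simp [leg23, LinearMap.lTensor_mul]

theorem flip12_mul_self : flip12 H * flip12 H = 1 := by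
  ext; rfl

theorem flip23_mul_self : flip23 H * flip23 H = 1 := by
  ext; rfl

theorem cycle_mul_flip23 : cycle H * flip23 H = flip12 H := by
  ext; rfl

theorem leg13_mul (X Y : Module.End ℂ (H ⊗[ℂ] H)) : leg13 (X * Y) = leg13 X * leg13 Y := by
  simp only [leg13, leg12_mul, mul_assoc]
  rw [← mul_assoc (flip23 H) (flip23 H), flip23_mul_self, one_mul]

theorem leg12_map (f g : Module.End ℂ H) : leg12 (TensorProduct.map f g) = slot1 f * slot2 g := by
  ext; rfl

theorem leg23_map (f g : Module.End ℂ H) : leg23 (TensorProduct.map f g) = slot2 f * slot3 g := by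
  ext; rfl

theorem leg13_map (f g : Module.End ℂ H) : leg13 (TensorProduct.map f g) = slot1 f * slot3 g := by
  ext; rfl

theorem leg12_map_id (f : Module.End ℂ H) : leg12 (TensorProduct.map f LinearMap.id) = slot1 f := by
  ext; rfl

theorem leg12_id_map (f : Module.End ℂ H) : leg12 (TensorProduct.map LinearMap.id f) = slot2 f := by
  ext; rfl

theorem leg23_map_id (f : Module.End ℂ H) : leg23 (TensorProduct.map f LinearMap.id) = slot2 f := by
  ext; rfl

theorem leg23_id_map (f : Module.End ℂ H) : leg23 (TensorProduct.map LinearMap.id f) = slot3 f := by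
  ext; rfl

theorem leg13_map_id (f : Module.End ℂ H) : leg13 (TensorProduct.map f LinearMap.id) = slot1 f := by
  ext; rfl

theorem leg13_id_map (f : Module.End ℂ H) : leg13 (TensorProduct.map LinearMap.id f) = slot3 f := by
  ext; rfl

theorem commute_slot3_leg12 (f : Module.End ℂ H) (X : Module.End ℂ (H ⊗[ℂ] H)) :
    Commute (slot3 f) (leg12 X) := by
  change TensorProduct.map LinearMap.id f ∘ₗ TensorProduct.map X LinearMap.id =
    TensorProduct.map X LinearMap.id ∘ₗ TensorProduct.map LinearMap.id f
  simp only [← TensorProduct.map_comp, LinearMap.id_comp, LinearMap.comp_id]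

theorem commute_slot1_leg23 (f : Module.End ℂ H) (X : Module.End ℂ (H ⊗[ℂ] H)) :
    Commute (slot1 f) (leg23 X) := by
  refine TensorProduct.ext_threefold fun a b c => ?_
  change slot1 f ((TensorProduct.assoc ℂ H H H).symm (a ⊗ₜ X (b ⊗ₜ c))) =
    (TensorProduct.assoc ℂ H H H).symm (f a ⊗ₜ X (b ⊗ₜ c))
  induction X (b ⊗ₜ c) using TensorProduct.induction_on with
  | zero => simp
  | tmul b c => rfl
  | add x y hx hy => simp only [TensorProduct.tmul_add, map_add, hx, hy]

theorem flip23_mul_slot2 (f : Module.End ℂ H) : flip23 H * slot2 f = slot3 f * flip23 H := by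
  ext; rfl

theorem flip23_mul_slot3 (f : Module.End ℂ H) : flip23 H * slot3 f = slot2 f * flip23 H := by
  ext; rfl

theorem commute_slot2_leg13 (f : Module.End ℂ H) (X : Module.End ℂ (H ⊗[ℂ] H)) :
    Commute (slot2 f) (leg13 X) := by
  change _ = _
  simp only [leg13, ← mul_assoc]
  rw [← flip23_mul_slot3, mul_assoc (flip23 H), (commute_slot3_leg12 f X).eq]
  simp only [mul_assoc]
  rw [flip23_mul_slot2]

theorem commute_slot1_slot2 (f g : Module.End ℂ H) : Commute (slot1 f) (slot2 g) := by
  change _ = _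
  ext; rfl

theorem commute_slot1_slot3 (f g : Module.End ℂ H) : Commute (slot1 f) (slot3 g) := by
  change _ = _
  ext; rfl

theorem commute_slot2_slot3 (f g : Module.End ℂ H) : Commute (slot2 f) (slot3 g) := by
  change _ = _
  ext; rfl

theorem flip23_mul_leg13 (X : Module.End ℂ (H ⊗[ℂ] H)) :
    flip23 H * leg13 X = leg12 X * flip23 H := by
  rw [leg13, ← mul_assoc, ← mul_assoc, flip23_mul_self, one_mul]

theorem flip23_mul_leg23 (X : Module.End ℂ (H ⊗[ℂ] H)) :
    flip23 H * leg23 X = leg32 X * flip23 H := by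
  rw [leg32, mul_assoc _ (flip23 H), flip23_mul_self, mul_one]

theorem leg21_mul_flip12 (X : Module.End ℂ (H ⊗[ℂ] H)) :
    leg21 X * flip12 H = flip12 H * leg12 X := by
  rw [leg21, mul_assoc _ (flip12 H), flip12_mul_self, mul_one]

/-- Conjugation by the flip of the first two factors exchanges the legs 23 and 13. -/
theorem flip12_mul_leg23 (X : Module.End ℂ (H ⊗[ℂ] H)) :
    flip12 H * leg23 X = leg13 X * flip12 H := by
  refine TensorProduct.ext_threefold fun a b c => ?_
  change flip12 H ((TensorProduct.assoc ℂ H H H).symm (a ⊗ₜ X (b ⊗ₜ c))) =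
    flip23 H (X (b ⊗ₜ c) ⊗ₜ a)
  induction X (b ⊗ₜ c) using TensorProduct.induction_on with
  | zero => simp
  | tmul b c => rfl
  | add x y hx hy => simp only [TensorProduct.tmul_add, TensorProduct.add_tmul, map_add, hx, hy]

theorem flip12_mul_leg13 (X : Module.End ℂ (H ⊗[ℂ] H)) :
    flip12 H * leg13 X = leg23 X * flip12 H := by
  rw [← mul_one (_ * _), ← flip12_mul_self, ← mul_assoc, mul_assoc (flip12 H), ← flip12_mul_leg23]
  simp only [← mul_assoc, flip12_mul_self, one_mul]

theorem leg12_sum {ι : Type*} [Fintype ι] (X : ι → Module.End ℂ (H ⊗[ℂ] H)) :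
    leg12 (∑ i, X i) = ∑ i, leg12 (X i) :=
  map_sum (LinearMap.rTensorHom H) X Finset.univ

theorem leg23_sum {ι : Type*} [Fintype ι] (X : ι → Module.End ℂ (H ⊗[ℂ] H)) :
    leg23 (∑ i, X i) = ∑ i, leg23 (X i) := by
  have h : (∑ i, X i).lTensor H = ∑ i, (X i).lTensor H :=
    map_sum (LinearMap.lTensorHom H) X Finset.univ
  refine LinearMap.ext fun ξ => ?_
  simp [leg23, h, LinearMap.sum_apply]

theorem leg13_sum {ι : Type*} [Fintype ι] (X : ι → Module.End ℂ (H ⊗[ℂ] H)) :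
    leg13 (∑ i, X i) = ∑ i, leg13 (X i) := by
  simp only [leg13, leg12_sum, Finset.mul_sum, Finset.sum_mul]

end LegCalculus

/-! ### The operator `V` -/

section Extension

variable {T : Type*} [AddCommGroup T] [Module ℂ T] {E Ehat : Module.End ℂ T}
  (U : LinearMap.range Ehat →ₗ[ℂ] LinearMap.range E)

theorem range_apply_of_idempotent {P : Module.End ℂ T} (hP : P * P = P)
    (ξ : LinearMap.range P) : P ξ = ξ := by
  obtain ⟨_, η, rfl⟩ := ξ
  exact LinearMap.congr_fun hP η

theorem coe_rangeRestrict_apply (P : Module.End ℂ T) (ξ : T) :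
    ((P.rangeRestrict ξ : LinearMap.range P) : T) = P ξ := rfl

theorem coe_arrow (P Q X : Module.End ℂ T) (ξ : LinearMap.range P) :
    (arrow P Q X ξ : T) = Q (X ξ) := rfl

theorem extendByProjections_apply (hE : E * E = E) (ξ : T) :
    extendByProjections U ξ = U (Ehat.rangeRestrict ξ) :=
  range_apply_of_idempotent hE _

theorem ambient_eq_extendByProjections (hE : E * E = E) : ambient U = extendByProjections U :=
  LinearMap.ext fun ξ => (extendByProjections_apply U hE ξ).symm

theorem projection_mul_extendByProjections (hE : E * E = E) :
    E * extendByProjections U = extendByProjections U := by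
  change E ∘ₗ (E ∘ₗ _) = _
  rw [← LinearMap.comp_assoc]
  exact congrArg (· ∘ₗ _) hE

theorem rangeRestrict_coe (hEhat : Ehat * Ehat = Ehat) (ξ : LinearMap.range Ehat) :
    Ehat.rangeRestrict ξ = ξ :=
  Subtype.ext (range_apply_of_idempotent hEhat ξ)

theorem extendByProjections_mul_projection (hEhat : Ehat * Ehat = Ehat) :
    extendByProjections U * Ehat = extendByProjections U := by
  refine LinearMap.ext fun ξ => ?_
  change E (U (Ehat.rangeRestrict (Ehat.rangeRestrict ξ : T))) = E (U (Ehat.rangeRestrict ξ))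
  rw [rangeRestrict_coe hEhat]

/-- An intertwining relation for `U` extends to `V` when the operators commute with the
projections. -/
theorem extendByProjections_mul_of_intertwines {X Y : Module.End ℂ T} (hE : E * E = E)
    (hX : Commute Ehat X) (hY : Commute E Y) (hEhat : Ehat * Ehat = Ehat)
    (h : U ∘ₗ arrow Ehat Ehat X = arrow E E Y ∘ₗ U) :
    extendByProjections U * X = Y * extendByProjections U := by
  refine LinearMap.ext fun ξ => ?_
  have h1 : Ehat.rangeRestrict (X ξ) = arrow Ehat Ehat X (Ehat.rangeRestrict ξ) := by
    refine Subtype.ext ?_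
    have h0 : Ehat * (X * Ehat) = Ehat * X := by rw [← hX.eq, ← mul_assoc, hEhat]
    exact (LinearMap.congr_fun h0 ξ).symm
  have h2 := congrArg Subtype.val (LinearMap.congr_fun h (Ehat.rangeRestrict ξ))
  change ((U (arrow Ehat Ehat X (Ehat.rangeRestrict ξ)) : LinearMap.range E) : T) =
    (E * Y) (U (Ehat.rangeRestrict ξ)) at h2
  change extendByProjections U (X ξ) = Y (extendByProjections U ξ)
  rw [extendByProjections_apply U hE, extendByProjections_apply U hE, h1, h2, hY.eq]
  exact congrArg Y (range_apply_of_idempotent hE _)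

theorem extendByProjections_mul_symm (U : LinearMap.range Ehat ≃ₗ[ℂ] LinearMap.range E)
    (hE : E * E = E) (hEhat : Ehat * Ehat = Ehat) :
    extendByProjections U.toLinearMap * extendByProjections U.symm.toLinearMap = E := by
  refine LinearMap.ext fun ξ => ?_
  change extendByProjections U.toLinearMap (extendByProjections U.symm.toLinearMap ξ) = E ξ
  rw [extendByProjections_apply _ hE, extendByProjections_apply _ hEhat, rangeRestrict_coe hEhat]
  change (U (U.symm (E.rangeRestrict ξ)) : T) = _
  rw [U.apply_symm_apply]
  rfl

end Extension

section PartialIsometry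

variable {T : Type*} [NormedAddCommGroup T] [InnerProductSpace ℂ T] [FiniteDimensional ℂ T]
  {E Ehat : Module.End ℂ T}

theorem inner_apply_left_of_star_eq {P : Module.End ℂ T} (hP : star P = P) (x y : T) :
    inner ℂ (P x) y = inner ℂ x (P y) := by
  rw [← LinearMap.adjoint_inner_right, ← LinearMap.star_eq_adjoint, hP]

/-- The adjoint of `E U Ê` is `Ê U⁻¹ E`. -/
theorem star_extendByProjections (U : LinearMap.range Ehat ≃ₗᵢ[ℂ] LinearMap.range E)
    (hE : E * E = E) (hE' : star E = E)
    (hEhat : Ehat * Ehat = Ehat) (hEhat' : star Ehat = Ehat) :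
    star (extendByProjections U.toLinearEquiv.toLinearMap) =
      extendByProjections U.symm.toLinearEquiv.toLinearMap := by
  symm
  rw [LinearMap.star_eq_adjoint, LinearMap.eq_adjoint_iff]
  intro η ξ
  rw [extendByProjections_apply _ hE, extendByProjections_apply _ hEhat]
  change inner ℂ (U.symm (E.rangeRestrict η) : T) ξ = inner ℂ η (U (Ehat.rangeRestrict ξ) : T)
  calc inner ℂ (U.symm (E.rangeRestrict η) : T) ξ
      = inner ℂ (Ehat (U.symm (E.rangeRestrict η) : T)) ξ := by
        rw [range_apply_of_idempotent hEhat]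
    _ = inner ℂ (U.symm (E.rangeRestrict η) : T) (Ehat ξ) := 
        inner_apply_left_of_star_eq hEhat' _ _
    _ = inner ℂ (U.symm (E.rangeRestrict η)) (Ehat.rangeRestrict ξ) := rfl
    _ = inner ℂ (E.rangeRestrict η) (U (Ehat.rangeRestrict ξ)) := by
        rw [← U.inner_map_map, U.apply_symm_apply]
    _ = inner ℂ (E η) (U (Ehat.rangeRestrict ξ) : T) := rfl
    _ = inner ℂ η (E (U (Ehat.rangeRestrict ξ) : T)) := 
        inner_apply_left_of_star_eq hE' _ _
    _ = inner ℂ η (U (Ehat.rangeRestrict ξ) : T) := by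
        rw [range_apply_of_idempotent hE]

end PartialIsometry

/-! ### The pentagon -/

section Pentagon

/-- The absorption of the intermediate projections in the two composites of the pentagon diagram.
The letters `P`, `Q` stand for the legs of `E`, `Ê`, the letters `f`, `s`, `c` for the flips
`Σ_{1,2}`, `Σ_{2,3}`, `Σ_{12,3}`. -/
theorem pentagon_of_diagram {A : Type*} [Monoid A]
    {V12 V23 V13 P12 P13 P23 P32 Q12 Q13 Q23 Q21 f s c : A}
    (hQ13 : Q13 * Q13 = Q13) (hQ23 : Q23 * Q23 = Q23)
    (r₁ : V12 * Q12 = V12) (r₂ : P12 * V12 = V12) (r₃ : V23 * Q23 = V23) (r₄ : P23 * V23 = V23)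
    (r₅ : V13 * Q13 = V13) (r₆ : P13 * V13 = V13)
    (c₁ : V12 * Q23 = Q23 * V12) (c₂ : P12 * V23 = V23 * P12)
    (c₃ : Q12 * Q23 = Q23 * Q12) (c₄ : P23 * Q13 = Q13 * P23)
    (m₁ : V23 * Q12 = Q13 * V23) (m₂ : V12 * P13 = P23 * V12) (m₃ : V13 * P23 = Q12 * V13)
    (f₁ : s * Q13 = Q12 * s) (f₂ : s * P23 = P32 * s) (f₃ : c * s = f) (f₄ : f * Q13 = Q23 * f)
    (f₅ : f * P23 = P13 * f) (f₆ : V23 * f = f * V13) (f₇ : Q21 * f = f * Q12)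
    (f₈ : P23 * f = f * P13) (f₉ : f * f = 1)
    (h : (P12 * P23) * V23 * ((P12 * Q23) * V12 * (Q12 * Q23)) =
      (P12 * P23) * V12 * ((P13 * Q12) * f * ((Q21 * P23) * V23 * ((P13 * Q23) * c *
        ((Q12 * P32) * s * ((Q13 * P23) * V23 * (Q12 * Q23))))))) :
    V23 * V12 = V12 * V13 * V23 := by
  have left : (P12 * P23) * V23 * ((P12 * Q23) * V12 * (Q12 * Q23)) = V23 * V12 := by
    have e1 : V12 * (Q12 * Q23) = Q23 * V12 := by rw [← mul_assoc, r₁, c₁]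
    have e2 : (P12 * Q23) * V12 * (Q12 * Q23) = Q23 * V12 := by
      rw [mul_assoc, e1, mul_assoc, ← mul_assoc Q23, hQ23, ← c₁, ← mul_assoc, r₂]
    rw [e2, mul_assoc P12, r₄, ← mul_assoc, mul_assoc P12, r₃, c₂, mul_assoc, r₂]
  -- With `B = Q13 V23`, which is `V23 (Q12 Q23)`, each map of the second composite acts as if the
  -- projections around it were absent.
  have e1 : V23 * (Q12 * Q23) = Q13 * V23 := by rw [c₃, ← mul_assoc, r₃, m₁]
  have e2 : P23 * (Q13 * V23) = Q13 * V23 := by rw [← mul_assoc, c₄, mul_assoc, r₄]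
  have e3 : Q13 * (Q13 * V23) = Q13 * V23 := by rw [← mul_assoc, hQ13]
  have e4 : V13 * (Q13 * V23) = V13 * V23 := by rw [← mul_assoc, r₅]
  generalize Q13 * V23 = B at e1 e2 e3 e4
  have e5 : (Q13 * P23) * V23 * (Q12 * Q23) = B := by rw [mul_assoc, e1, mul_assoc, e2, e3]
  have e6 : (Q12 * P32) * s * B = s * B := by
    rw [mul_assoc Q12, ← f₂, ← mul_assoc, ← f₁, mul_assoc, mul_assoc, e2, e3]
  have e7 : (P13 * Q23) * c * (s * B) = f * B := by
    rw [mul_assoc _ c, ← mul_assoc c, f₃, ← mul_assoc, mul_assoc P13, ← f₄, ← mul_assoc, ← f₅,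
      mul_assoc, mul_assoc, e3, e2]
  have e8 : P13 * (V13 * B) = V13 * B := by rw [← mul_assoc, r₆]
  have e9 : Q12 * (V13 * B) = V13 * B := by rw [← mul_assoc, ← m₃, mul_assoc, e2]
  have e10 : (Q21 * P23) * V23 * (f * B) = f * (V13 * B) := by
    rw [mul_assoc _ V23, ← mul_assoc V23, f₆, mul_assoc f, mul_assoc Q21, ← mul_assoc P23, f₈,
      mul_assoc f, e8, ← mul_assoc, f₇, mul_assoc, e9]
  have e11 : (P13 * Q12) * f * (f * (V13 * B)) = V13 * B := by
    rw [mul_assoc _ f, ← mul_assoc f, f₉, one_mul, mul_assoc, e9, e8]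
  have e12 : (P12 * P23) * V12 * (V13 * B) = V12 * (V13 * B) := by
    rw [mul_assoc P12, ← m₂, mul_assoc P12, mul_assoc V12, e8, ← mul_assoc, r₂]
  rw [left, e5, e6, e7, e10, e11, e12, e4, ← mul_assoc] at h
  exact h

end Pentagon

/-! ### Intertwining relations and the legs of `V`, `E` and `Ê` -/

section LegsOfV

variable {N : Type*} [CStarAlgebra N] [PartialOrder N] [StarOrderedRing N]
  [FiniteDimensional ℂ N] {ν : N →ₚ[ℂ] ℂ} {hν : IsFaithfulFunctional ν}
  {H : Type*} [NormedAddCommGroup H] [InnerProductSpace ℂ H] [FiniteDimensional ℂ H]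
  {β : N →⋆ₙₐ[ℂ] Module.End ℂ H} {α : Nᵐᵒᵖ →⋆ₙₐ[ℂ] Module.End ℂ H}
  {βhat : N →⋆ₙₐ[ℂ] Module.End ℂ H}

theorem commute_sum_map {ι : Type*} [Fintype ι] {H : Type*} [AddCommGroup H] [Module ℂ H]
    {p q : ι → Module.End ℂ H} {f g : Module.End ℂ H} (hp : ∀ i, Commute (p i) f)
    (hq : ∀ i, Commute (q i) g) :
    Commute (∑ i, TensorProduct.map (p i) (q i)) (TensorProduct.map f g) :=
  Commute.sum_left _ _ _ fun i _ => by
    change _ * _ = _ * _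
    rw [← TensorProduct.map_mul, ← TensorProduct.map_mul, (hp i).eq, (hq i).eq]

/-- The perimeter relations satisfied by `V` on all of `H ⊗ H`. -/
structure IntertwinesPerimeter (β : N →⋆ₙₐ[ℂ] Module.End ℂ H) (α : Nᵐᵒᵖ →⋆ₙₐ[ℂ] Module.End ℂ H)
    (βhat : N →⋆ₙₐ[ℂ] Module.End ℂ H) (V : Module.End ℂ (H ⊗[ℂ] H)) : Prop where
  left_left : ∀ x, V * TensorProduct.map (β x) LinearMap.id =
    TensorProduct.map (β x) LinearMap.id * V
  right_left : ∀ x, V * TensorProduct.map LinearMap.id (β x) =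
    TensorProduct.map (βhat x) LinearMap.id * V
  right_right : ∀ x, V * TensorProduct.map LinearMap.id (βhat x) =
    TensorProduct.map LinearMap.id (βhat x) * V
  left_right : ∀ x, V * TensorProduct.map (α x) LinearMap.id =
    TensorProduct.map LinearMap.id (α x) * V

theorem IsPseudoMultiplicative.intertwinesPerimeter
    (hindex : functionalIndex ν hν = 1)
    (hβα : ∀ x y, Commute (β x) (α y)) (hββhat : ∀ x y, Commute (β x) (βhat y))
    (hαβhat : ∀ x y, Commute (α x) (βhat y))
    {U : LinearMap.range (relProjOp ν hν βhat α) ≃ₗᵢ[ℂ] LinearMap.range (relProj ν hν α β)}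
    (hU : IsPseudoMultiplicative ν hν β α βhat U) :
    IntertwinesPerimeter β α βhat (extendByProjections U.toLinearEquiv.toLinearMap) := by
  have hE := relProj_mul_self ν hν α β hindex
  have hEhat := relProjOp_mul_self ν hν α βhat hindex
  have id_right : ∀ f : Module.End ℂ H, Commute f (LinearMap.id : Module.End ℂ H) :=
    Commute.one_right
  refine ⟨fun x => ?_, fun x => ?_, fun x => ?_, fun x => ?_⟩
  · exact extendByProjections_mul_of_intertwines _ hE
      (commute_sum_map (fun i => (hββhat x _).symm) fun i => id_right _)
      (commute_sum_map (fun i => (hβα x _).symm) fun i => id_right _) hEhat (hU.intertwines_01 x)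
  · exact extendByProjections_mul_of_intertwines _ hE
      (commute_sum_map (fun i => id_right _) fun i => (hβα x _).symm)
      (commute_sum_map (fun i => hαβhat _ x) fun i => id_right _) hEhat (hU.intertwines_12 x)
  · exact extendByProjections_mul_of_intertwines _ hE
      (commute_sum_map (fun i => id_right _) fun i => hαβhat _ x)
      (commute_sum_map (fun i => id_right _) fun i => hββhat _ x) hEhat (hU.intertwines_23 x)
  · exact extendByProjections_mul_of_intertwines _ hE
      (commute_sum_map (fun i => (hαβhat x _).symm) fun i => id_right _)
      (commute_sum_map (fun i => id_right _) fun i => hβα _ x) hEhat (hU.intertwines_03 x)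

theorem commute_leg12_relProjOp_leg23_relProjOp (hαβhat : ∀ x y, Commute (α x) (βhat y)) :
    Commute (leg12 (relProjOp ν hν βhat α)) (leg23 (relProjOp ν hν βhat α)) := by
  simp only [relProjOp, leg12_sum, leg23_sum, leg12_map, leg23_map]
  refine Commute.sum_left _ _ _ fun i _ => Commute.sum_right _ _ _ fun j _ => ?_
  have h : Commute (slot2 (α (MulOpposite.op (relV ν hν i)))) (slot2 (βhat (relU ν hν j))) := by
    change _ * _ = _ * _
    rw [← leg12_id_map, ← leg12_id_map, ← leg12_mul, ← leg12_mul, ← LinearMap.lTensor_def,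
      ← LinearMap.lTensor_def, ← LinearMap.lTensor_mul, ← LinearMap.lTensor_mul, (hαβhat _ _).eq]
  exact ((commute_slot1_slot2 _ _).mul_right (commute_slot1_slot3 _ _)).mul_left
    (h.mul_right (commute_slot2_slot3 _ _))

theorem commute_leg23_relProj_leg13_relProjOp (hβα : ∀ x y, Commute (β x) (α y)) :
    Commute (leg23 (relProj ν hν α β)) (leg13 (relProjOp ν hν βhat α)) := by
  simp only [relProj, relProjOp, leg13_sum, leg23_sum, leg13_map, leg23_map]
  refine Commute.sum_left _ _ _ fun i _ => Commute.sum_right _ _ _ fun j _ => ?_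
  have h : Commute (slot3 (β (relV ν hν i))) (slot3 (α (MulOpposite.op (relV ν hν j)))) := by
    change LinearMap.lTensor _ _ * LinearMap.lTensor _ _ =
      LinearMap.lTensor _ _ * LinearMap.lTensor _ _
    rw [← LinearMap.lTensor_mul, ← LinearMap.lTensor_mul, (hβα _ _).eq]
  exact ((commute_slot1_slot2 _ _).symm.mul_right (commute_slot2_slot3 _ _)).mul_left
    ((commute_slot1_slot3 _ _).symm.mul_right h)

variable {V : Module.End ℂ (H ⊗[ℂ] H)} (hV : IntertwinesPerimeter β α βhat V)
include hV

theorem leg12_mul_leg23_relProjOp :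
    leg12 V * leg23 (relProjOp ν hν βhat α) = leg23 (relProjOp ν hν βhat α) * leg12 V := by
  simp only [relProjOp, leg23_sum, leg23_map, Finset.mul_sum, Finset.sum_mul]
  refine Finset.sum_congr rfl fun i _ => ?_
  rw [← mul_assoc, ← leg12_id_map, ← leg12_mul, hV.right_right, leg12_mul, mul_assoc,
    ← (commute_slot3_leg12 _ V).eq, mul_assoc]

theorem leg12_relProj_mul_leg23 :
    leg12 (relProj ν hν α β) * leg23 V = leg23 V * leg12 (relProj ν hν α β) := by
  simp only [relProj, leg12_sum, leg12_map, Finset.mul_sum, Finset.sum_mul]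
  refine Finset.sum_congr rfl fun i _ => ?_
  rw [mul_assoc, ← leg23_map_id, ← leg23_mul, ← hV.left_left, leg23_mul, ← mul_assoc,
    (commute_slot1_leg23 _ V).eq, mul_assoc]

theorem leg23_mul_leg12_relProjOp :
    leg23 V * leg12 (relProjOp ν hν βhat α) = leg13 (relProjOp ν hν βhat α) * leg23 V := by
  simp only [relProjOp, leg12_sum, leg13_sum, leg12_map, leg13_map, Finset.mul_sum,
    Finset.sum_mul]
  refine Finset.sum_congr rfl fun i _ => ?_
  rw [← mul_assoc, ← (commute_slot1_leg23 _ V).eq, mul_assoc, ← leg23_map_id, ← leg23_mul,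
    hV.left_right, leg23_mul, leg23_id_map, mul_assoc]

theorem leg12_mul_leg13_relProj :
    leg12 V * leg13 (relProj ν hν α β) = leg23 (relProj ν hν α β) * leg12 V := by
  simp only [relProj, leg23_sum, leg13_sum, leg23_map, leg13_map, Finset.mul_sum,
    Finset.sum_mul]
  refine Finset.sum_congr rfl fun i _ => ?_
  rw [← mul_assoc, ← leg12_map_id, ← leg12_mul, hV.left_right, leg12_mul, leg12_id_map, mul_assoc,
    ← (commute_slot3_leg12 _ V).eq, mul_assoc]

/-- Unlike the other relations between the legs of `V` and those of `E`, `Ê`, this one exchanges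
the two tensor factors of `e_ν`, and so depends on the symmetry of `e_ν`. -/
theorem leg13_mul_leg23_relProj (hindex : functionalIndex ν hν = 1) :
    leg13 V * leg23 (relProj ν hν α β) = leg12 (relProjOp ν hν βhat α) * leg13 V := by
  simp only [relProj_eq ν hν α β hindex, relProjOp_eq ν hν α βhat hindex, leg23_sum, leg12_sum,
    leg23_map, leg12_map, Finset.mul_sum, Finset.sum_mul]
  refine Finset.sum_congr rfl fun i _ => ?_
  rw [← mul_assoc, ← (commute_slot2_leg13 _ V).eq, mul_assoc, ← leg13_id_map, ← leg13_mul,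
    hV.right_left, leg13_mul, leg13_map_id, ← mul_assoc, ← (commute_slot1_slot2 _ _).eq]

end LegsOfV

/-! ### From pseudo-multiplicative isometries to multiplicative partial isometries -/

theorem mainTheorem8
    {N : Type*} [CStarAlgebra N] [PartialOrder N] [StarOrderedRing N] [FiniteDimensional ℂ N]
    (ν : N →ₚ[ℂ] ℂ) (hν : IsFaithfulFunctional ν) (hindex : functionalIndex ν hν = 1)
    {H : Type*} [NormedAddCommGroup H] [InnerProductSpace ℂ H] [FiniteDimensional ℂ H]
    (β : N →⋆ₙₐ[ℂ] Module.End ℂ H) (α : Nᵐᵒᵖ →⋆ₙₐ[ℂ] Module.End ℂ H)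
    (βhat : N →⋆ₙₐ[ℂ] Module.End ℂ H)
    (hβα : ∀ x y, Commute (β x) (α y)) (hββhat : ∀ x y, Commute (β x) (βhat y))
    (hαβhat : ∀ x y, Commute (α x) (βhat y))
    (U : LinearMap.range (relProjOp ν hν βhat α) ≃ₗᵢ[ℂ] LinearMap.range (relProj ν hν α β))
    (hU : IsPseudoMultiplicative ν hν β α βhat U)
    (V : Module.End ℂ (H ⊗[ℂ] H))
    (hV : V = extendByProjections U.toLinearEquiv.toLinearMap) :
    IsMultiplicativePartialIsometry V ∧
      V * star V = relProj ν hν α β ∧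
      star V * V = relProjOp ν hν βhat α ∧
      ∀ ξ : LinearMap.range (relProjOp ν hν βhat α), V ξ = U ξ := by
  have hE := relProj_mul_self ν hν α β hindex
  have hEhat := relProjOp_mul_self ν hν α βhat hindex
  have hW : IntertwinesPerimeter β α βhat V := by
    rw [hV]
    exact hU.intertwinesPerimeter hindex hβα hββhat hαβhat
  have hstar := star_extendByProjections U hE (star_relProj ν hν α β hindex) hEhat
    (star_relProjOp ν hν α βhat hindex)
  have hVV : V * star V = relProj ν hν α β := by
    rw [hV, hstar]
    exact extendByProjections_mul_symm U.toLinearEquiv hE hEhat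
  have hVV' : star V * V = relProjOp ν hν βhat α := by
    rw [hV, hstar]
    exact extendByProjections_mul_symm U.symm.toLinearEquiv hEhat hE
  have hEV : relProj ν hν α β * V = V := by
    rw [hV]
    exact projection_mul_extendByProjections _ hE
  have hVE : V * relProjOp ν hν βhat α = V := by
    rw [hV]
    exact extendByProjections_mul_projection _ hEhat
  have c₁ : leg12 V * leg23 (relProjOp ν hν βhat α) = leg23 (relProjOp ν hν βhat α) * leg12 V :=
    leg12_mul_leg23_relProjOp hW
  have c₂ : leg12 (relProj ν hν α β) * leg23 V = leg23 V * leg12 (relProj ν hν α β) :=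
    leg12_relProj_mul_leg23 hW
  have m₃ := leg13_mul_leg23_relProj hW hindex
  refine ⟨⟨?_, ?_, ?_, ?_, ?_⟩, hVV, hVV', fun ξ => ?_⟩
  · rw [hVV, hEV]
  · refine pentagon_of_diagram (P12 := leg12 (relProj ν hν α β)) (P13 := leg13 (relProj ν hν α β))
      (P23 := leg23 (relProj ν hν α β)) (P32 := leg32 (relProj ν hν α β))
      (Q12 := leg12 (relProjOp ν hν βhat α)) (Q13 := leg13 (relProjOp ν hν βhat α))
      (Q23 := leg23 (relProjOp ν hν βhat α)) (Q21 := leg21 (relProjOp ν hν βhat α))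
      (f := flip12 H) (s := flip23 H) (c := cycle H)
      (by rw [← leg13_mul, hEhat]) (by rw [← leg23_mul, hEhat]) (by rw [← leg12_mul, hVE])
      (by rw [← leg12_mul, hEV]) (by rw [← leg23_mul, hVE]) (by rw [← leg23_mul, hEV])
      (by rw [← leg13_mul, hVE]) (by rw [← leg13_mul, hEV]) c₁ c₂
      (commute_leg12_relProjOp_leg23_relProjOp hαβhat).eq
      (commute_leg23_relProj_leg13_relProjOp hβα).eq
      (leg23_mul_leg12_relProjOp hW) (leg12_mul_leg13_relProj hW) m₃
      (flip23_mul_leg13 _) (flip23_mul_leg23 _) cycle_mul_flip23 (flip12_mul_leg13 _)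
      (flip12_mul_leg23 _) (flip12_mul_leg13 _).symm (leg21_mul_flip12 _)
      (flip12_mul_leg13 _).symm flip12_mul_self ?_
    -- Both composites start on the range of `Ê₁₂ Ê₂₃`, hence the extra factor `Ê₁₂ Ê₂₃` when they
    -- are compared as operators on the whole space.
    have hpent := hU.pentagon
    simp only [ambient_eq_extendByProjections _ hE, ← hV] at hpent
    refine LinearMap.ext fun η => ?_
    have hη := congrArg Subtype.val (LinearMap.congr_fun hpent
      ((leg12 (relProjOp ν hν βhat α) * leg23 (relProjOp ν hν βhat α)).rangeRestrict η))
    simp only [LinearMap.comp_apply, coe_arrow, coe_rangeRestrict_apply,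
      Module.End.mul_apply] at hη ⊢
    exact hη
  · rw [mul_assoc, ← leg23_mul, hVV, ← leg12_mul, hVV', m₃]
  · rw [← leg12_mul, hVV, mul_assoc, ← leg12_mul, hVV, c₂]
  · rw [mul_assoc, ← leg23_mul, hVV', c₁]
  · rw [hV, extendByProjections_apply _ hE, rangeRestrict_coe hEhat]
    rfl
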